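/- Let $k \le r \le n$ be positive integers. A partition of the cake $[0,1]$ into $k$ intervals (from left to right, intervals of length zero being allowed) is identified with the vector $x=(x_1,\dots,x_k)$ of its lengths, a point of the simplex $\Delta^{k-1}=\{x\in\mathbb{R}^k : x_j\ge 0,\ \sum_j x_j=1\}$. There are $n$ guests; for every partition, each guest has a (possibly empty) set of favorite pieces. Assume that the guests are $r$-hungry, that is: - for every partition of $[0,1]$ into $k$ intervals and any $n-r+1$ of the guests, at least one of these guests has a favorite piece of positive length; - for every guest and every $j\in\{1,\dots,k\}$, the set of partitions $x\in\Delta^{k-1}$ in which the $j$-th piece is one of the guest's favorites is closed. Then there is a partition of $[0,1]$ into $k$ intervals such that, for every set $S$ of exactly $\lceil (r-k)/k\rceil$ guests, the $k$ pieces can be assigned to $k$ distinct guests not in $S$, each of whom receives one of their favorite pieces. -/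

import Mathlib

namespace CakeCutting

/-- A partition of the cake `[0,1]` into `k` intervals, listed from left to right and allowed to
have length zero, is recorded by the vector of its lengths: a point of the standard
`(k-1)`-simplex (with its usual topology). -/
abbrev CakePartition (k : ℕ) : Type := stdSimplex ℝ (Fin k)

/-- The `m`-th cut point: the total length of the first `m` pieces. -/
noncomputable def cut {k : ℕ} (x : CakePartition k) (m : ℕ) : ℝ :=
  ∑ i : Fin k with i.val < m, x.1 i

/-- The `j`-th piece, as an interval of the cake. -/
noncomputable def piece {k : ℕ} (x : CakePartition k) (j : Fin k) : Set ℝ :=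
  Set.Icc (cut x j.val) (cut x (j.val + 1))

theorem cut_succ {k : ℕ} (x : CakePartition k) (j : Fin k) :
    cut x (j.val + 1) = cut x j.val + x.1 j := by
  have h : (Finset.univ.filter fun i : Fin k => i.val < j.val + 1)
      = insert j (Finset.univ.filter fun i : Fin k => i.val < j.val) := by
    ext i
    simp only [Finset.mem_filter, Finset.mem_univ, true_and, Finset.mem_insert, Fin.ext_iff]
    omega
  unfold cut
  rw [h, Finset.sum_insert (by simp), add_comm]

theorem cut_zero {k : ℕ} (x : CakePartition k) : cut x 0 = 0 := by
  simp [cut]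

theorem cut_last {k : ℕ} (x : CakePartition k) : cut x k = 1 := by
  simpa [cut] using x.2.2

/-- The length of the `j`-th piece is the `j`-th coordinate. -/
theorem volume_piece {k : ℕ} (x : CakePartition k) (j : Fin k) :
    MeasureTheory.volume (piece x j) = ENNReal.ofReal (x.1 j) := by
  rw [piece, Real.volume_Icc, cut_succ, add_sub_cancel_left]

theorem volume_piece_pos_iff {k : ℕ} (x : CakePartition k) (j : Fin k) :
    0 < MeasureTheory.volume (piece x j) ↔ 0 < x.1 j := by
  rw [volume_piece, ENNReal.ofReal_pos]

/-- The preferences of one guest: to every partition of the cake the guest assigns the set of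
(indices of) favorite pieces. The set may be empty (the guest rejects the partition) and may
contain several pieces. -/
abbrev Preference (k : ℕ) : Type := CakePartition k → Set (Fin k)

/-- A preference is closed if, for each `j`, the set of partitions in which the `j`-th piece
is a favorite is closed. -/
def Preference.Closed {k : ℕ} (p : Preference k) : Prop :=
  ∀ j : Fin k, IsClosed {x : CakePartition k | j ∈ p x}

/-- For `1 ≤ α ≤ n`: the `n` guests are `α`-hungry if, for every partition, among any
`n - α + 1` guests at least one has a favorite piece of positive length, and every guest has
closed preferences. -/
structure Hungry {n k : ℕ} (α : ℕ) (p : Fin n → Preference k) : Prop where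
  exists_prefers : ∀ (x : CakePartition k) (C : Finset (Fin n)), C.card = n - α + 1 →
    ∃ i ∈ C, ∃ j ∈ p i x, 0 < MeasureTheory.volume (piece x j)
  closed : ∀ i : Fin n, (p i).Closed

end CakeCutting

/-! Fix `ε > 0`. Each guest spreads a weight of at most one over the nonempty pieces that are
favorites at some partition within `ε`, continuously in the partition and so that at every partition
at least `r` guests spend a full unit. A KKM argument finds a partition at which all pieces receive
equal weight, hence at least `r / k` each. As a guest gives at most one, any set `J` of pieces is
`ε`-nearly liked by at least `|J| r / k` guests. Compactness and closed preferences let `ε → 0`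
(`Hungry.exists_card_mul_le`). Deleting a set `S` with `|S| < r / k` leaves more than `|J| - 1`
guests for every nonempty `J`, because `k ≤ r`, and Hall's theorem assigns the pieces. The partition
does not depend on `S`.

The KKM statement `exists_forall_mem_of_facet_subset` comes from Scarf's lemma
`exists_colorful_dominant`, which is proved by a parity count of doors and rooms. -/

namespace Scarf

/-! ### Scarf's lemma by a parity argument. -/

open Finset

set_option linter.unusedSectionVars false

variable {I X : Type*}

/-- A set of points is dominant for the family of orders `H i` if no point lies strictly above
the minimum of the set in each of these orders. -/
def Dominant (H : I → X → ℕ) (R : Finset X) : Prop :=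
  ∀ y, ∃ i, ∀ x ∈ R, H i y ≤ H i x

theorem Dominant.mono {H : I → X → ℕ} {R R' : Finset X} (h : Dominant H R) (hR : R' ⊆ R) :
    Dominant H R' := fun y => (h y).imp fun _ hi x hx => hi x (hR hx)

variable [Fintype I] [DecidableEq I] [Fintype X] [DecidableEq X]

/-- The points strictly above `m i` for every order other than the order `a`. -/
def above (H : I → X → ℕ) (m : I → X) (a : I) : Finset X := by
  classical exact univ.filter fun y => ∀ i, i ≠ a → H i (m i) < H i y

theorem mem_above {H : I → X → ℕ} {m : I → X} {a : I} {y : X} :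
    y ∈ above H m a ↔ ∀ i, i ≠ a → H i (m i) < H i y := by
  simp [above]

/-- `m` chooses the minima of `τ`, and takes the same value at the two indices `a` and `b`. -/
structure IsMinima (H : I → X → ℕ) (τ : Finset X) (m : I → X) (a b : I) : Prop where
  mem : ∀ i, m i ∈ τ
  le : ∀ i, ∀ x ∈ τ, H i (m i) ≤ H i x
  ne : a ≠ b
  eq : m a = m b
  inj_left : ∀ i j, i ≠ a → j ≠ a → m i = m j → i = j
  inj_right : ∀ i j, i ≠ b → j ≠ b → m i = m j → i = j

theorem IsMinima.symm {H : I → X → ℕ} {τ : Finset X} {m : I → X} {a b : I}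
    (h : IsMinima H τ m a b) : IsMinima H τ m b a :=
  ⟨h.mem, h.le, h.ne.symm, h.eq.symm, h.inj_right, h.inj_left⟩

/-- Dominance tested at a point of `τ` makes that point the minimum of some order. So `m` maps `I`
onto a set with one element fewer, and exactly one pair of indices collides. -/
theorem exists_isMinima {H : I → X → ℕ} (hH : ∀ i, Function.Injective (H i)) {τ : Finset X}
    (hne : τ.Nonempty) (hcard : τ.card + 1 = Fintype.card I) (hdom : Dominant H τ) :
    ∃ m a b, IsMinima H τ m a b := by
  choose m hm hle using fun i => τ.exists_min_image (H i) hne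
  have hsurj : ∀ x ∈ τ, ∃ i, m i = x := fun x hx => by
    obtain ⟨i, hi⟩ := hdom x
    exact ⟨i, hH i (le_antisymm (hle i x hx) (hi _ (hm i)))⟩
  obtain ⟨a, -, b, -, hab, heq⟩ := exists_ne_map_eq_of_card_lt_of_maps_to
    (s := (univ : Finset I)) (t := τ) (by rw [card_univ]; omega) (fun i _ => hm i)
  have key : ∀ a b, a ≠ b → m a = m b → ∀ i j, i ≠ a → j ≠ a → m i = m j → i = j := by
    intro a b hab heq i j hi hj hij
    have hs : Set.SurjOn m (univ.erase a : Finset I) (τ : Set X) := by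
      intro x hx
      obtain ⟨l, rfl⟩ := hsurj x hx
      by_cases hl : l = a
      · exact ⟨b, by simpa using hab.symm, by rw [hl, heq]⟩
      · exact ⟨l, by simpa using hl, rfl⟩
    exact injOn_of_surjOn_of_card_le m (fun i _ => hm i) hs
      (by rw [card_erase_of_mem (mem_univ _), card_univ]; omega)
      (by simpa using hi) (by simpa using hj) hij
  exact ⟨m, a, b, hm, hle, hab, heq, key a b hab heq, key b a hab.symm heq.symm⟩

theorem IsMinima.notMem_of_mem_above {H : I → X → ℕ} (hH : ∀ i, Function.Injective (H i))
    {τ : Finset X} {m : I → X} {a b : I} (h : IsMinima H τ m a b) (hdom : Dominant H τ)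
    {y : X} (hy : y ∈ above H m a) : y ∉ τ := by
  intro hyτ
  rw [mem_above] at hy
  obtain ⟨i, hi⟩ := hdom y
  have hyi : m i = y := hH i (le_antisymm (h.le i y hyτ) (hi _ (h.mem i)))
  by_cases hia : i = a
  · have := hy b h.ne.symm
    have h2 : m b = y := by rw [← h.eq, ← hia, hyi]
    rw [h2] at this
    exact lt_irrefl _ this
  · have := hy i hia
    rw [hyi] at this
    exact lt_irrefl _ this

theorem IsMinima.notMem_above_right {H : I → X → ℕ} {τ : Finset X} {m : I → X} {a b : I}
    (h : IsMinima H τ m a b) (hdom : Dominant H τ)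
    {y : X} (hya : y ∈ above H m a) : y ∉ above H m b := by
  intro hyb
  rw [mem_above] at hya hyb
  obtain ⟨i, hi⟩ := hdom y
  have hi := hi _ (h.mem i)
  by_cases hia : i = a
  · exact absurd (hyb i (hia ▸ h.ne)) (not_lt.2 hi)
  · exact absurd (hya i hia) (not_lt.2 hi)

/-- The new point takes over as minimum of order `a` only; `m a` is still the minimum of order `b`.
Points outside `above H m a` are handled by the unchanged orders, the others by maximality of `y`.
-/
theorem IsMinima.dominant_insert {H : I → X → ℕ} {τ : Finset X} {m : I → X} {a b : I}
    (h : IsMinima H τ m a b) (hdom : Dominant H τ)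
    {y : X} (hy : y ∈ above H m a) (hmax : ∀ z ∈ above H m a, H a z ≤ H a y) :
    Dominant H (insert y τ) := by
  intro z
  have hya : H a y ≤ H a (m a) := by
    obtain ⟨i, hi⟩ := hdom y
    by_cases hia : i = a
    · exact hia ▸ hi _ (h.mem i)
    · exact absurd (mem_above.1 hy i hia) (not_lt.2 (hi _ (h.mem i)))
  by_cases hz : z ∈ above H m a
  · refine ⟨a, fun x hx => ?_⟩
    rcases mem_insert.1 hx with rfl | hx
    · exact hmax z hz
    · exact (hmax z hz).trans (hya.trans (h.le a x hx))
  · rw [mem_above] at hz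
    push Not at hz
    obtain ⟨i, hia, hi⟩ := hz
    refine ⟨i, fun x hx => ?_⟩
    rcases mem_insert.1 hx with rfl | hx
    · exact hi.trans (mem_above.1 hy i hia).le
    · exact hi.trans (h.le i x hx)

/-- Every old point must stay the minimum of some order (`hmin`), so `y` can displace the minimum
only in one of the two orders that share one. -/
theorem IsMinima.of_dominant_insert {H : I → X → ℕ} (hH : ∀ i, Function.Injective (H i))
    {τ : Finset X} {m : I → X} {a b : I} (h : IsMinima H τ m a b)
    {y : X} (hy : y ∉ τ) (hdom : Dominant H (insert y τ)) :
    (y ∈ above H m a ∧ ∀ z ∈ above H m a, H a z ≤ H a y) ∨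
      (y ∈ above H m b ∧ ∀ z ∈ above H m b, H b z ≤ H b y) := by
  have hmin : ∀ i, ∃ j, m j = m i ∧ H j (m j) < H j y := fun i => by
    obtain ⟨j, hj⟩ := hdom (m i)
    have hji : m j = m i := hH j (le_antisymm (h.le j _ (h.mem i))
      (hj _ (mem_insert_of_mem (h.mem j))))
    refine ⟨j, hji, lt_of_le_of_ne (hji ▸ hj y (mem_insert_self _ _)) fun he => hy ?_⟩
    rw [← hH j he]
    exact h.mem j
  have key : ∀ a b, IsMinima H τ m a b → (∀ x ∈ insert y τ, H a y ≤ H a x) →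
      (y ∈ above H m a ∧ ∀ z ∈ above H m a, H a z ≤ H a y) := by
    intro a b h ha
    have hya : y ∈ above H m a := by
      rw [mem_above]
      intro i hi
      obtain ⟨j, hji, hj⟩ := hmin i
      by_cases hja : j = a
      · subst hja
        exact absurd hj (not_lt.2 (ha _ (mem_insert_of_mem (h.mem _))))
      · exact h.inj_left j i hja hi hji ▸ hj
    refine ⟨hya, fun z hz => ?_⟩
    obtain ⟨i, hi⟩ := hdom z
    by_cases hia : i = a
    · exact hia ▸ hi y (mem_insert_self _ _)
    · exact absurd (mem_above.1 hz i hia) (not_lt.2 (hi _ (mem_insert_of_mem (h.mem i))))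
  obtain ⟨i, hi⟩ := hdom y
  by_cases hia : i = a
  · exact Or.inl (key a b h (hia ▸ hi))
  by_cases hib : i = b
  · exact Or.inr (key b a h.symm (hib ▸ hi))
  · exfalso
    obtain ⟨j, hji, hj⟩ := hmin i
    have hij : j = i := by
      by_cases hja : j = a
      · subst hja
        exact h.inj_right j i h.ne hib hji
      · exact h.inj_left j i hja hia hji
    subst hij
    exact absurd hj (not_lt.2 (hi _ (mem_insert_of_mem (h.mem _))))

open Classical in
/-- The dominant sets with one point for every order. -/
noncomputable def rooms (H : I → X → ℕ) : Finset (Finset X) :=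
  univ.filter fun R => R.card = Fintype.card I ∧ Dominant H R

theorem mem_rooms {H : I → X → ℕ} {R : Finset X} :
    R ∈ rooms H ↔ R.card = Fintype.card I ∧ Dominant H R := by
  simp [rooms]

/-- A dominant `τ` lies in exactly two rooms, one for each of the colliding indices; any other `τ`
lies in none. -/
theorem even_card_rooms_of_above_nonempty {H : I → X → ℕ} (hH : ∀ i, Function.Injective (H i))
    {τ : Finset X} (hne : τ.Nonempty) (hcard : τ.card + 1 = Fintype.card I)
    (habove : ∀ m : I → X, (∀ i, m i ∈ τ) → (∀ i, ∀ x ∈ τ, H i (m i) ≤ H i x) →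
      ∀ a, (above H m a).Nonempty) :
    Even ((rooms H).filter fun R => τ ⊆ R).card := by
  by_cases hdom : Dominant H τ
  · obtain ⟨m, a, b, h⟩ := exists_isMinima hH hne hcard hdom
    obtain ⟨y, hy, hymax⟩ := (above H m a).exists_max_image (H a) (habove m h.mem h.le a)
    obtain ⟨z, hz, hzmax⟩ := (above H m b).exists_max_image (H b) (habove m h.mem h.le b)
    have hyτ := h.notMem_of_mem_above hH hdom hy
    have hzτ := h.symm.notMem_of_mem_above hH hdom hz
    have hset : ((rooms H).filter fun R => τ ⊆ R) = {insert y τ, insert z τ} := by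
      ext R
      simp only [mem_filter, mem_rooms, mem_insert, mem_singleton]
      constructor
      · rintro ⟨⟨hR, hRdom⟩, hτR⟩
        obtain ⟨w, hw, rfl⟩ := exists_eq_insert_iff.2 ⟨hτR, hcard.trans hR.symm⟩
        rcases h.of_dominant_insert hH hw hRdom with ⟨hwa, hwm⟩ | ⟨hwa, hwm⟩
        · exact Or.inl (by rw [hH a (le_antisymm (hymax w hwa) (hwm y hy))])
        · exact Or.inr (by rw [hH b (le_antisymm (hzmax w hwa) (hwm z hz))])
      · rintro (rfl | rfl)
        · exact ⟨⟨by rw [card_insert_of_notMem hyτ, hcard], h.dominant_insert hdom hy hymax⟩,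
            subset_insert _ _⟩
        · exact ⟨⟨by rw [card_insert_of_notMem hzτ, hcard],
            h.symm.dominant_insert hdom hz hzmax⟩, subset_insert _ _⟩
    have hne : insert y τ ≠ insert z τ := fun he => by
      have : y ∈ insert z τ := he ▸ mem_insert_self y τ
      rcases mem_insert.1 this with rfl | hmem
      · exact h.notMem_above_right hdom hy hz
      · exact hyτ hmem
    rw [hset, card_pair hne]
    exact even_two
  · rw [filter_eq_empty_iff.2 fun R hR hτ => hdom ((mem_rooms.1 hR).2.mono hτ)]
    simp

open Classical in
/-- The sets carrying every colour but `o` exactly once. -/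
noncomputable def doors (c : X → I) (o : I) : Finset (Finset X) :=
  univ.filter fun τ => τ.card + 1 = Fintype.card I ∧ τ.image c = univ.erase o

theorem mem_doors {c : X → I} {o : I} {τ : Finset X} :
    τ ∈ doors c o ↔ τ.card + 1 = Fintype.card I ∧ τ.image c = univ.erase o := by
  simp [doors]

/-- Adding `x` to a door without completing the colours repeats the colour of a single `x'`; only
removing `x` or `x'` leaves a door. -/
theorem even_card_doors {c : X → I} {o : I} {R : Finset X} (hR : R.card = Fintype.card I)
    (hc : R.image c ≠ univ) : Even ((doors c o).filter fun τ => τ ⊆ R).card := by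
  rcases ((doors c o).filter fun τ => τ ⊆ R).eq_empty_or_nonempty with he | ⟨τ, hτ⟩
  · simp [he]
  rw [mem_filter, mem_doors] at hτ
  obtain ⟨⟨hcard, himg⟩, hτR⟩ := hτ
  obtain ⟨x, hx, rfl⟩ := exists_eq_insert_iff.2 ⟨hτR, hcard.trans hR.symm⟩
  have hinj : Set.InjOn c τ := by
    rw [← card_image_iff, himg, card_erase_of_mem (mem_univ _), card_univ]
    omega
  have hcx : c x ≠ o := fun h => hc (by
    rw [image_insert, himg, h, insert_erase (mem_univ _)])
  have hcτ : ∀ w ∈ τ, c w ≠ o := fun w hw => by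
    have := mem_image_of_mem c hw
    rw [himg] at this
    exact (mem_erase.1 this).1
  have hcol : ∀ i, i ≠ o → ∃ w ∈ τ, c w = i := fun i hi => by
    have : i ∈ τ.image c := himg ▸ mem_erase.2 ⟨hi, mem_univ _⟩
    exact mem_image.1 this
  obtain ⟨x', hx', hxx'⟩ := hcol (c x) hcx
  have hne : x ≠ x' := fun h => hx (h ▸ hx')
  have hset : ((doors c o).filter fun σ => σ ⊆ insert x τ) = {τ, (insert x τ).erase x'} := by
    ext σ
    simp only [mem_filter, mem_doors, mem_insert, mem_singleton]
    constructor
    · rintro ⟨⟨hσ, hσc⟩, hσR⟩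
      obtain ⟨z, hz, hzR⟩ := exists_eq_insert_iff.2 ⟨hσR, hσ.trans hR.symm⟩
      have hσz : σ = (insert x τ).erase z := by rw [← hzR, erase_insert hz]
      by_cases hzx : z = x
      · left; rw [hσz, hzx, erase_insert hx]
      by_cases hzx' : z = x'
      · right; rw [hσz, hzx']
      exfalso
      have hzτ : z ∈ τ := by
        have : z ∈ insert x τ := hzR ▸ mem_insert_self z σ
        exact (mem_insert.1 this).resolve_left hzx
      have : c z ∈ σ.image c := hσc ▸ mem_erase.2 ⟨hcτ z hzτ, mem_univ _⟩
      obtain ⟨w, hw, hwz⟩ := mem_image.1 this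
      rcases mem_insert.1 (hσR hw) with rfl | hwτ
      · exact hzx' (hinj hzτ hx' (hwz.symm.trans hxx'.symm))
      · exact hz (hinj hwτ hzτ hwz ▸ hw)
    · rintro (rfl | rfl)
      · exact ⟨⟨hcard, himg⟩, subset_insert _ _⟩
      · refine ⟨⟨?_, ?_⟩, erase_subset _ _⟩
        · rw [card_erase_of_mem (mem_insert_of_mem hx'), card_insert_of_notMem hx]
          omega
        · ext i
          simp only [mem_image, mem_erase, mem_insert, mem_univ, and_true]
          constructor
          · rintro ⟨w, ⟨-, rfl | hw⟩, rfl⟩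
            · exact hcx
            · exact hcτ w hw
          · intro hi
            obtain ⟨w, hw, rfl⟩ := hcol i hi
            by_cases hwx : w = x'
            · exact ⟨x, ⟨hne, Or.inl rfl⟩, by rw [hwx, hxx']⟩
            · exact ⟨w, ⟨hwx, Or.inr hw⟩, rfl⟩
  rw [hset, card_pair]
  · exact even_two
  · intro h
    have : x' ∈ (insert x τ).erase x' := h ▸ hx'
    simp at this

/-- The rooms containing the face opposite to `s o` of the boundary simplex `s`. -/
theorem card_rooms_boundary {H : I → X → ℕ} (hH : ∀ i, Function.Injective (H i)) {s : I → X}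
    (hs : Function.Injective s)
    (hbot : ∀ i x, H i (s i) ≤ H i x)
    (htop : ∀ x, x ∉ Set.range s → ∀ i j, i ≠ j → H i x < H i (s j))
    (hT : ∃ x, x ∉ Set.range s) (o : I) :
    ((rooms H).filter fun R => (univ.erase o).image s ⊆ R).card = 1 := by
  classical
  obtain ⟨t, ht, htmax⟩ := (univ.filter fun x => x ∉ Set.range s).exists_max_image (H o)
    (hT.imp fun x hx => by simpa using hx)
  simp only [mem_filter, mem_univ, true_and] at ht htmax
  have hcard : ((univ.erase o).image s).card + 1 = Fintype.card I := by
    rw [card_image_of_injective _ hs, card_erase_of_mem (mem_univ _), card_univ]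
    have : 0 < Fintype.card I := Fintype.card_pos_iff.2 ⟨o⟩
    omega
  have htn : t ∉ (univ.erase o).image s := fun h => by
    obtain ⟨j, -, rfl⟩ := mem_image.1 h
    exact ht ⟨j, rfl⟩
  rw [card_eq_one]
  refine ⟨insert t ((univ.erase o).image s), ?_⟩
  ext R
  simp only [mem_filter, mem_rooms, mem_singleton]
  constructor
  · rintro ⟨⟨hR, hRdom⟩, hsub⟩
    obtain ⟨y, hy, rfl⟩ := exists_eq_insert_iff.2 ⟨hsub, hcard.trans hR.symm⟩
    obtain ⟨i, hi⟩ := hRdom t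
    by_cases hio : i = o
    · subst hio
      have hty := hi y (mem_insert_self _ _)
      have hyr : y ∉ Set.range s := by
        rintro ⟨j, rfl⟩
        by_cases hj : j = i
        · subst hj
          exact ht ⟨j, hH j (le_antisymm (hbot j t) hty)⟩
        · exact hy (mem_image_of_mem s (by simpa using hj))
      rw [hH i (le_antisymm (htmax y hyr) hty)]
    · have := hi (s i) (mem_insert_of_mem (mem_image_of_mem s (by simpa using hio)))
      exact absurd ⟨i, hH i (le_antisymm (hbot i t) this)⟩ ht
  · rintro rfl
    refine ⟨⟨by rw [card_insert_of_notMem htn, hcard], fun z => ?_⟩, subset_insert _ _⟩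
    by_cases hz : z ∈ Set.range s
    · obtain ⟨j, rfl⟩ := hz
      exact ⟨j, fun x _ => hbot j x⟩
    · refine ⟨o, fun x hx => ?_⟩
      rcases mem_insert.1 hx with rfl | hx
      · exact htmax z hz
      · obtain ⟨j, hj, rfl⟩ := mem_image.1 hx
        exact (htop z hz o j (mem_erase.1 hj).1.symm).le

/-- Incidences between doors and rooms are counted twice. Without a colourful room every room has
evenly many doors, while every door lies in evenly many rooms except the boundary face opposite `s
o`, which lies in one. -/
theorem exists_colorful_room [Nonempty I] {H : I → X → ℕ} (hH : ∀ i, Function.Injective (H i))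
    {s : I → X} (hbot : ∀ i x, H i (s i) ≤ H i x)
    (htop : ∀ x, x ∉ Set.range s → ∀ i j, i ≠ j → H i x < H i (s j))
    (hT : ∃ x, x ∉ Set.range s) {c : X → I} (hc : ∀ i, c (s i) = i) :
    ∃ R, R.card = Fintype.card I ∧ Dominant H R ∧ R.image c = univ := by
  classical
  by_contra! hcon
  obtain ⟨o⟩ := ‹Nonempty I›
  have hs : Function.Injective s := Function.LeftInverse.injective hc
  have hcount := sum_card_bipartiteAbove_eq_sum_card_bipartiteBelow
    (s := doors c o) (t := rooms H) (fun τ R => τ ⊆ R)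
  have heven : Even (∑ R ∈ rooms H, ((doors c o).filter fun τ => τ ⊆ R).card) :=
    even_sum _ fun R hR => even_card_doors (mem_rooms.1 hR).1
      (hcon R (mem_rooms.1 hR).1 (mem_rooms.1 hR).2)
  have hbd : (univ.erase o).image s ∈ doors c o := by
    rw [mem_doors]
    constructor
    · rw [card_image_of_injective _ hs, card_erase_of_mem (mem_univ _), card_univ]
      have : 0 < Fintype.card I := Fintype.card_pos_iff.2 ⟨o⟩
      omega
    · rw [image_image]
      simp [Function.comp_def, hc]
  have hrest : Even (∑ τ ∈ (doors c o).erase ((univ.erase o).image s),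
      ((rooms H).filter fun R => τ ⊆ R).card) := by
    refine even_sum _ fun τ hτ => ?_
    obtain ⟨hne, hτ⟩ := mem_erase.1 hτ
    rw [mem_doors] at hτ
    have hx : ∃ x ∈ τ, x ∉ Set.range s := by
      by_contra! hall
      refine hne (Subset.antisymm (fun x hx => ?_) (fun x hx => ?_))
      · obtain ⟨j, rfl⟩ := hall x hx
        have := mem_image_of_mem c hx
        rw [hτ.2, hc] at this
        exact mem_image_of_mem s this
      · obtain ⟨j, hj, rfl⟩ := mem_image.1 hx
        rw [← hτ.2] at hj
        obtain ⟨y, hy, hyj⟩ := mem_image.1 hj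
        obtain ⟨l, rfl⟩ := hall y hy
        rw [hc] at hyj
        exact hyj ▸ hy
    obtain ⟨x, hxτ, hxs⟩ := hx
    -- One non-vertex `x` in `τ` bounds all minima, so `s a` exceeds them in every order but `a`.
    refine even_card_rooms_of_above_nonempty hH ⟨x, hxτ⟩ hτ.1 fun m _ hle a => ⟨s a, ?_⟩
    rw [mem_above]
    exact fun i hi => (hle i x hxτ).trans_lt (htop x hxs i a hi)
  have hone := card_rooms_boundary hH hs hbot htop hT o
  rw [show (∑ R ∈ rooms H, ((doors c o).filter fun τ => τ ⊆ R).card)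
    = ∑ τ ∈ doors c o, ((rooms H).filter fun R => τ ⊆ R).card from hcount.symm,
    ← add_sum_erase _ _ hbd, hone] at heven
  rw [Nat.even_add] at heven
  exact Nat.not_even_one (heven.2 hrest)

/-- Scarf's lemma: for any colouring of a finite set by the indices of a family of linear orders
there is a dominant pair `(σ, C)` such that `σ` carries all colours of `C`. -/
theorem exists_colorful_dominant {T : Type*} [Fintype T] [Nonempty T] [Nonempty I]
    (h : I → T → ℕ) (hh : ∀ i, Function.Injective (h i)) (c : T → I) :
    ∃ (C : Finset I) (σ : Finset T), (∀ i ∈ C, ∃ x ∈ σ, c x = i) ∧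
      ∀ y, ∃ i ∈ C, ∀ x ∈ σ, h i y ≤ h i x := by
  classical
  obtain ⟨B, hB⟩ : ∃ B, ∀ i t, h i t < B := by
    refine ⟨(∑ i, ∑ t, h i t) + 1, fun i t => Nat.lt_succ_of_le ?_⟩
    exact (single_le_sum (f := fun t => h i t) (fun _ _ => Nat.zero_le _) (mem_univ t)).trans
      (single_le_sum (f := fun i => ∑ t, h i t) (fun _ _ => Nat.zero_le _) (mem_univ i))
  let e := Fintype.equivFin I
  -- Vertex `j` is the bottom of order `j` and above all of `T` in the others; `e j` separates the
  -- vertices.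
  let H : I → T ⊕ I → ℕ := fun i => Sum.elim (fun t => h i t + 1)
    (fun j => if j = i then 0 else B + 1 + e j)
  have hHl : ∀ i t, H i (Sum.inl t) = h i t + 1 := fun _ _ => rfl
  have hHr : ∀ i j, H i (Sum.inr j) = if j = i then 0 else B + 1 + e j := fun _ _ => rfl
  have hH : ∀ i, Function.Injective (H i) := by
    rintro i (t | j) (t' | j') he
    · rw [hHl, hHl] at he
      rw [hh i (Nat.succ_injective he)]
    · rw [hHl, hHr] at he
      have := hB i t
      split_ifs at he; all_goals omega
    · rw [hHl, hHr] at he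
      have := hB i t'
      split_ifs at he; all_goals omega
    · rw [hHr, hHr] at he
      split_ifs at he with h1 h2 h2
      · rw [h1, h2]
      · omega
      · omega
      · rw [e.injective (Fin.ext (show (e j : ℕ) = e j' by omega))]
  obtain ⟨R, hR, hdom, himg⟩ := exists_colorful_room (H := H) hH (s := Sum.inr)
    (fun i x => by rw [hHr, if_pos rfl]; exact Nat.zero_le _)
    (fun x hx i j hij => by
      rcases x with t | l
      · rw [hHl, hHr, if_neg hij.symm]
        have := hB i t
        omega
      · exact absurd ⟨l, rfl⟩ hx)
    (by obtain ⟨t⟩ := ‹Nonempty T›; exact ⟨Sum.inl t, by simp⟩)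
    (c := Sum.elim c id) (fun i => rfl)
  -- If vertex `i` is in `R`, order `i` has minimum zero there and cannot dominate a point of `T`;
  -- otherwise colour `i` must come from `T`.
  refine ⟨univ.filter fun i => Sum.inr i ∉ R, univ.filter fun t => Sum.inl t ∈ R, ?_, ?_⟩
  · intro i hi
    have : i ∈ R.image (Sum.elim c id) := himg ▸ mem_univ i
    obtain ⟨t | j, hx, rfl⟩ := mem_image.1 this
    · exact ⟨t, by simpa using hx, rfl⟩
    · exact absurd hx (mem_filter.1 hi).2
  · intro y
    obtain ⟨i, hi⟩ := hdom (Sum.inl y)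
    refine ⟨i, ?_, fun x hx => ?_⟩
    · rw [mem_filter]
      refine ⟨mem_univ _, fun hiR => ?_⟩
      have := hi _ hiR
      rw [hHl, hHr, if_pos rfl] at this
      omega
    · have := hi _ (mem_filter.1 hx).2
      rw [hHl, hHl] at this
      omega

end Scarf

/-! ### From Scarf's lemma to the KKM theorem on the simplex. -/

namespace Scarf

open Finset Filter Topology

/-- The point of the standard simplex with barycentric coordinates `v i / N`. -/
noncomputable def latticePoint {k N : ℕ} (hN : 0 < N) (v : Fin k → ℕ) (hv : ∑ i, v i = N) :
    stdSimplex ℝ (Fin k) :=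
  ⟨fun i => (v i : ℝ) / N, fun i => by positivity, by
    rw [← Finset.sum_div, ← Nat.cast_sum, hv]
    exact div_self (by positivity)⟩

/-- A cover of the simplex: some lattice point is close, for each `i`, to the `i`-th member of
the cover or to the `i`-th facet. -/
theorem exists_near_cover_or_facet {k N : ℕ} (hk : 0 < k) (hN : 0 < N)
    (D : Fin k → Set (stdSimplex ℝ (Fin k))) (hcov : ∀ x, ∃ i, x ∈ D i) :
    ∃ x : stdSimplex ℝ (Fin k), ∀ i, (∃ y ∈ D i, dist y x ≤ k / N) ∨ x.1 i ≤ k / N := by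
  classical
  let T := {v : Fin k → ℕ // v ∈ piAntidiag univ N}
  let _ : Fintype T := Finset.fintypeCoeSort (piAntidiag univ N)
  have hsum : ∀ v : T, ∑ i, v.1 i = N := fun v => (mem_piAntidiag.1 v.2).1
  have hmk : ∀ v : Fin k → ℕ, ∑ i, v i = N → v ∈ piAntidiag univ N := fun v hv =>
    mem_piAntidiag.2 ⟨hv, fun _ _ => mem_univ _⟩
  let o : Fin k := ⟨0, hk⟩
  have : Nonempty (Fin k) := ⟨o⟩
  have : Nonempty T := ⟨⟨Pi.single o N, hmk _ (by simp)⟩⟩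
  choose c hc using fun v : T => hcov (latticePoint hN v.1 (hsum v))
  let e := Fintype.equivFin T
  -- Order by the `i`-th coordinate, with ties broken by `e`.
  let h : Fin k → T → ℕ := fun i v => v.1 i * Fintype.card T + e v
  have hle : ∀ i v w, h i v ≤ h i w → v.1 i ≤ w.1 i := by
    intro i v w hvw
    by_contra! hlt
    have h1 : (w.1 i + 1) * Fintype.card T ≤ v.1 i * Fintype.card T :=
      Nat.mul_le_mul_right _ hlt
    have h2 := (e w).2
    have h3 : v.1 i * Fintype.card T + e v ≤ w.1 i * Fintype.card T + e w := hvw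
    rw [add_mul] at h1
    omega
  have hinj : ∀ i, Function.Injective (h i) := by
    intro i v w hvw
    have h1 := le_antisymm (hle i v w hvw.le) (hle i w v hvw.ge)
    have h2 : v.1 i * Fintype.card T + e v = w.1 i * Fintype.card T + e w := hvw
    rw [h1] at h2
    exact e.injective (Fin.ext (by omega))
  obtain ⟨C, σ, hcol, hdom⟩ := exists_colorful_dominant h hinj c
  obtain ⟨i₀, hi₀, -⟩ := hdom (Classical.arbitrary T)
  obtain ⟨v₀, hv₀, -⟩ := hcol i₀ hi₀
  choose μ hμ hμle using fun i => σ.exists_min_image (h i) ⟨v₀, hv₀⟩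
  -- Otherwise some lattice point, with the surplus placed on `i₀`, strictly exceeds every minimum
  -- on `C`, against dominance. Hence the minima on `C` sum to more than `N - k`, which confines `σ`
  -- to a region of width `k`.
  have hbig : N < ∑ i ∈ C, ((μ i).1 i + 1) := by
    by_contra! hsmall
    let y : Fin k → ℕ := fun i => (if i ∈ C then (μ i).1 i + 1 else 0) +
      if i = i₀ then N - ∑ i ∈ C, ((μ i).1 i + 1) else 0
    have hy : ∑ i, y i = N := by
      simp only [y, sum_add_distrib, sum_ite_eq', mem_univ, if_true, sum_ite_mem, univ_inter]
      rw [sum_add_distrib] at hsmall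
      omega
    obtain ⟨i, hi, hiy⟩ := hdom ⟨y, hmk y hy⟩
    have h1 := hle i _ _ (hiy (μ i) (hμ i))
    have h2 : (μ i).1 i + 1 ≤ y i := by simp [y, hi]
    exact absurd (h2.trans h1) (by omega)
  have hCk : C.card ≤ k := by simpa using card_le_univ C
  have hmin : ∀ v ∈ σ, ∀ i, (μ i).1 i ≤ v.1 i := fun v hv i => hle i _ _ (hμle i v hv)
  rw [sum_add_distrib, sum_const, smul_eq_mul, mul_one] at hbig
  have hin : ∀ v ∈ σ, ∀ i ∈ C, v.1 i ≤ (μ i).1 i + k := by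
    intro v hv i hi
    have h1 : ∑ j ∈ C, v.1 j ≤ N := by
      refine le_trans ?_ (hsum v).le
      exact sum_le_sum_of_subset (subset_univ _)
    have h2 : ∑ j ∈ C.erase i, (μ j).1 j ≤ ∑ j ∈ C.erase i, v.1 j :=
      sum_le_sum fun j _ => hmin v hv j
    rw [← add_sum_erase _ _ hi] at h1 hbig
    omega
  have hout : ∀ v ∈ σ, ∀ i, i ∉ C → v.1 i ≤ k := by
    intro v hv i hi
    have h1 : v.1 i + ∑ j ∈ C, v.1 j ≤ N := by
      refine le_trans ?_ (hsum v).le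
      rw [← sum_insert hi]
      exact sum_le_sum_of_subset (subset_univ _)
    have h2 : ∑ j ∈ C, (μ j).1 j ≤ ∑ j ∈ C, v.1 j := sum_le_sum fun j _ => hmin v hv j
    omega
  have hclose : ∀ v ∈ σ, ∀ w ∈ σ, ∀ i, v.1 i ≤ w.1 i + k := by
    intro v hv w hw i
    by_cases hi : i ∈ C
    · have := hin v hv i hi
      have := hmin w hw i
      omega
    · have := hout v hv i hi
      omega
  have hN' : (0 : ℝ) < N := by exact_mod_cast hN
  refine ⟨latticePoint hN v₀.1 (hsum v₀), fun i => ?_⟩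
  by_cases hi : i ∈ C
  · left
    obtain ⟨v, hv, rfl⟩ := hcol i hi
    refine ⟨_, hc v, ?_⟩
    rw [Subtype.dist_eq, dist_pi_le_iff (by positivity)]
    intro j
    have h1 : (v.1 j : ℝ) ≤ v₀.1 j + k := by exact_mod_cast hclose v hv v₀ hv₀ j
    have h2 : (v₀.1 j : ℝ) ≤ v.1 j + k := by exact_mod_cast hclose v₀ hv₀ v hv j
    simp only [latticePoint]
    rw [Real.dist_eq, ← sub_div, abs_div, abs_of_pos hN']
    gcongr
    rw [abs_le]
    constructor <;> linarith
  · right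
    simp only [latticePoint]
    gcongr
    exact_mod_cast hout v₀ hv₀ i hi

/-- Sperner's version of the Knaster–Kuratowski–Mazurkiewicz theorem: closed sets covering the
simplex, the `i`-th of which contains the `i`-th facet, have a common point. -/
theorem exists_forall_mem_of_facet_subset {k : ℕ} (hk : 0 < k)
    (D : Fin k → Set (stdSimplex ℝ (Fin k))) (hclosed : ∀ i, IsClosed (D i))
    (hcov : ∀ x, ∃ i, x ∈ D i) (hfacet : ∀ i x, x.1 i = 0 → x ∈ D i) :
    ∃ x, ∀ i, x ∈ D i := by
  choose u hu using fun N : ℕ => exists_near_cover_or_facet hk N.succ_pos D hcov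
  obtain ⟨x, φ, hφ, hx⟩ := CompactSpace.tendsto_subseq u
  have hrate : Tendsto (fun n : ℕ => (k : ℝ) / ((φ n).succ : ℕ)) atTop (𝓝 0) := by
    have h1 : Tendsto (fun n : ℕ => (k : ℝ) / (n + 1)) atTop (𝓝 0) := by
      simpa [Function.comp_def] using
        (tendsto_const_div_atTop_nhds_zero_nat (k : ℝ)).comp (tendsto_add_atTop_nat 1)
    simpa [Function.comp_def] using h1.comp hφ.tendsto_atTop
  refine ⟨x, fun i => ?_⟩
  by_contra hxi
  have hpos : 0 < x.1 i := lt_of_le_of_ne (x.2.1 i) fun h => hxi (hfacet i x h.symm)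
  have hcoord : Tendsto (fun n => (u (φ n)).1 i - (k : ℝ) / ((φ n).succ : ℕ)) atTop
      (𝓝 (x.1 i - 0)) := by
    refine Tendsto.sub ?_ hrate
    have hcont : Continuous fun z : stdSimplex ℝ (Fin k) => z.1 i :=
      (continuous_apply i).comp continuous_subtype_val
    exact (hcont.tendsto x).comp hx
  rw [sub_zero] at hcoord
  obtain ⟨ε, hε, hball⟩ := Metric.isOpen_iff.1 (hclosed i).isOpen_compl x hxi
  have hdist : Tendsto (fun n => (k : ℝ) / ((φ n).succ : ℕ) + dist (u (φ n)) x) atTop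
      (𝓝 (0 + 0)) := hrate.add (tendsto_iff_dist_tendsto_zero.1 hx)
  rw [add_zero] at hdist
  obtain ⟨n, h1, h2⟩ := ((hcoord.eventually (lt_mem_nhds hpos)).and
    (hdist.eventually (gt_mem_nhds hε))).exists
  rcases hu (φ n) i with ⟨y, hy, hyd⟩ | hle
  · refine hball ?_ hy
    rw [Metric.mem_ball]
    exact (dist_triangle y (u (φ n)) x).trans_lt (by linarith)
  · linarith

end Scarf

/-! ### Weights, equalization and the limit. -/

namespace CakeCutting

open Finset Filter Topology

/-- A continuous positive lower bound for the `r`-th largest of finitely many continuous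
functions. -/
theorem exists_continuous_pos_le {X ι : Type*} [TopologicalSpace X] [Fintype ι]
    {r : ℕ} (hr : 0 < r) (U : ι → X → ℝ) (hU : ∀ i, Continuous (U i))
    (hpos : ∀ x, ∃ R : Finset ι, R.card = r ∧ ∀ i ∈ R, 0 < U i x) :
    ∃ ρ : X → ℝ, Continuous ρ ∧ (∀ x, 0 < ρ x) ∧
      ∀ x, ∃ R : Finset ι, R.card = r ∧ ∀ i ∈ R, ρ x ≤ U i x := by
  classical
  rcases isEmpty_or_nonempty X with hX | ⟨⟨x₀⟩⟩
  · exact ⟨fun _ => 1, continuous_const, fun x => isEmptyElim x, fun x => isEmptyElim x⟩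
  let P : Finset (Finset ι) := powersetCard r univ
  have hP : ∀ {R}, R ∈ P ↔ R.card = r := fun {R} => by simp [P, mem_powersetCard]
  have hne : ∀ R ∈ P, R.Nonempty := fun R hR => card_pos.1 ((hP.1 hR).symm ▸ hr)
  have hPne : P.attach.Nonempty := by
    obtain ⟨R, hR, -⟩ := hpos x₀
    exact ⟨⟨R, hP.2 hR⟩, mem_attach _ _⟩
  refine ⟨fun x => P.attach.sup' hPne fun R => R.1.inf' (hne R.1 R.2) fun i => U i x, ?_, ?_, ?_⟩
  · exact Continuous.finset_sup'_apply hPne fun R _ =>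
      Continuous.finset_inf'_apply _ fun i _ => hU i
  · intro x
    obtain ⟨R, hR, hRU⟩ := hpos x
    exact (lt_sup'_iff _).2 ⟨⟨R, hP.2 hR⟩, mem_attach _ _, (lt_inf'_iff _).2 hRU⟩
  · intro x
    obtain ⟨R, -, hR⟩ := exists_mem_eq_sup' hPne
      fun R : P => R.1.inf' (hne R.1 R.2) fun i => U i x
    exact ⟨R.1, hP.1 R.2, fun i hi => hR.trans_le (inf'_le _ hi)⟩

/-- A nonnegative matrix with row sums at most one and column sums at least `r / k`
satisfies a fractional Hall condition. -/
theorem card_mul_le_of_weights {ι : Type*} [Fintype ι] {k r : ℕ} (w : ι → Fin k → ℝ)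
    (hw : ∀ i j, 0 ≤ w i j) (hrow : ∀ i, ∑ j, w i j ≤ 1)
    (hcol : ∀ j, (r : ℝ) ≤ k * ∑ i, w i j) (J : Finset (Fin k)) (N : Finset ι)
    (hN : ∀ i, i ∉ N → ∀ j ∈ J, w i j = 0) : J.card * r ≤ k * N.card := by
  have h1 : ∑ j ∈ J, (r : ℝ) ≤ ∑ j ∈ J, k * ∑ i, w i j := sum_le_sum fun j _ => hcol j
  have h2 : ∑ i, ∑ j ∈ J, w i j ≤ ∑ i ∈ N, (1 : ℝ) := by
    rw [← sum_subset (subset_univ N) fun i _ hi => sum_eq_zero (hN i hi)]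
    exact sum_le_sum fun i _ =>
      (sum_le_sum_of_subset_of_nonneg (subset_univ J) fun j _ _ => hw i j).trans (hrow i)
  rw [← mul_sum, sum_comm, sum_const, nsmul_eq_mul] at h1
  rw [sum_const, nsmul_eq_mul, mul_one] at h2
  have h3 : (J.card : ℝ) * r ≤ k * N.card := h1.trans (by gcongr)
  exact_mod_cast h3

variable {n k r : ℕ}

theorem Hungry.exists_card_eq {p : Fin n → Preference k} (hp : Hungry r p) (hrn : r ≤ n)
    (x : CakePartition k) :
    ∃ R : Finset (Fin n), R.card = r ∧ ∀ i ∈ R, ∃ j ∈ p i x, 0 < x.1 j := by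
  classical
  let A : Finset (Fin n) := univ.filter fun i => ∃ j ∈ p i x, 0 < x.1 j
  have hA : r ≤ A.card := by
    by_contra! hlt
    have hc : n - r + 1 ≤ Aᶜ.card := by
      rw [card_compl, Fintype.card_fin]
      omega
    obtain ⟨C, hCA, hC⟩ := exists_subset_card_eq hc
    obtain ⟨i, hi, j, hj, hpos⟩ := hp.exists_prefers x C hC
    exact mem_compl.1 (hCA hi)
      (mem_filter.2 ⟨mem_univ _, j, hj, (volume_piece_pos_iff x j).1 hpos⟩)
  obtain ⟨R, hRA, hR⟩ := exists_subset_card_eq hA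
  exact ⟨R, hR, fun i hi => (mem_filter.1 (hRA hi)).2⟩

/-- The length factor in `u` kills empty pieces, and the thickened indicator makes preferences
continuous. Dividing by the maximum of the row sum and `ρ` keeps continuity where a row sum
vanishes, and gives total exactly one to the guests whose row sum is at least `ρ`. -/
theorem Hungry.exists_weights {p : Fin n → Preference k} (hp : Hungry r p) (hr : 0 < r)
    (hrn : r ≤ n) {ε : ℝ} (hε : 0 < ε) :
    ∃ w : Fin n → Fin k → CakePartition k → ℝ,
      (∀ i j, Continuous (w i j)) ∧ (∀ i j x, 0 ≤ w i j x) ∧ (∀ i x, ∑ j, w i j x ≤ 1) ∧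
      (∀ x, (r : ℝ) ≤ ∑ j, ∑ i, w i j x) ∧ (∀ i j x, x.1 j = 0 → w i j x = 0) ∧
      ∀ i j x, x ∉ Metric.thickening ε {y | j ∈ p i y} → w i j x = 0 := by
  let u : Fin n → Fin k → CakePartition k → ℝ := fun i j x =>
    x.1 j * thickenedIndicator hε {y | j ∈ p i y} x
  have hu0 : ∀ i j x, 0 ≤ u i j x := fun i j x => mul_nonneg (x.2.1 j) (NNReal.coe_nonneg _)
  have huc : ∀ i j, Continuous (u i j) := fun i j =>
    ((continuous_apply j).comp continuous_subtype_val).mul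
      (NNReal.continuous_coe.comp (thickenedIndicator hε _).continuous)
  have hUc : ∀ i, Continuous fun x => ∑ j, u i j x := fun i =>
    continuous_finsetSum _ fun j _ => huc i j
  obtain ⟨ρ, hρ, hρpos, hρle⟩ := exists_continuous_pos_le hr (fun i x => ∑ j, u i j x) hUc
    fun x => by
      obtain ⟨R, hR, h⟩ := hp.exists_card_eq hrn x
      refine ⟨R, hR, fun i hi => ?_⟩
      obtain ⟨j, hj, hpos⟩ := h i hi
      refine sum_pos' (fun j _ => hu0 i j x) ⟨j, mem_univ _, ?_⟩
      have : thickenedIndicator hε {y | j ∈ p i y} x = 1 := thickenedIndicator_one hε _ hj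
      simpa only [u, this, NNReal.coe_one, mul_one] using hpos
  have hden : ∀ i x, 0 < max (∑ j, u i j x) (ρ x) := fun i x => lt_max_of_lt_right (hρpos x)
  have hnn : ∀ i j x, 0 ≤ u i j x / max (∑ j, u i j x) (ρ x) := fun i j x =>
    div_nonneg (hu0 i j x) (hden i x).le
  refine ⟨fun i j x => u i j x / max (∑ j, u i j x) (ρ x), fun i j => ?_, hnn,
    fun i x => ?_, fun x => ?_, fun i j x hx => ?_, fun i j x hx => ?_⟩
  · exact (huc i j).div ((hUc i).max hρ) fun x => (hden i x).ne'
  · rw [← sum_div]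
    exact div_le_one_of_le₀ (le_max_left _ _) (hden i x).le
  · obtain ⟨R, hR, hRle⟩ := hρle x
    rw [sum_comm]
    calc (r : ℝ) = ∑ i ∈ R, (1 : ℝ) := by simp [hR]
      _ = ∑ i ∈ R, ∑ j, u i j x / max (∑ j, u i j x) (ρ x) := by
        refine sum_congr rfl fun i hi => ?_
        have h1 := hden i x
        rw [max_eq_left (hRle i hi)] at h1 ⊢
        rw [← sum_div, div_self h1.ne']
      _ ≤ _ := sum_le_sum_of_subset_of_nonneg (subset_univ R) fun i _ _ =>
        sum_nonneg fun j _ => hnn i j x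
  · simp [u, hx]
  · simp only [u]
    rw [thickenedIndicator_zero hε _ hx, NNReal.coe_zero, mul_zero, zero_div]

open Classical in
theorem Hungry.exists_card_mul_le_thickening {p : Fin n → Preference k} (hp : Hungry r p)
    (hk : 0 < k) (hr : 0 < r) (hrn : r ≤ n) {ε : ℝ} (hε : 0 < ε) :
    ∃ x : CakePartition k, ∀ J : Finset (Fin k), J.card * r ≤
      k * (univ.filter fun i => ∃ j ∈ J, x ∈ Metric.thickening ε {y | j ∈ p i y}).card := by
  obtain ⟨w, hwc, hw, hrow, htot, hfacet, hthick⟩ := hp.exists_weights hr hrn hε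
  have hfc : ∀ j, Continuous fun x => ∑ i, w i j x := fun j =>
    continuous_finsetSum _ fun i _ => hwc i j
  obtain ⟨x, hx⟩ := Scarf.exists_forall_mem_of_facet_subset hk
    (fun j => {x | k * ∑ i, w i j x ≤ ∑ l, ∑ i, w i l x})
    (fun j => isClosed_le (continuous_const.mul (hfc j)) (continuous_finsetSum _ fun l _ => hfc l))
    (fun x => by
      obtain ⟨j, -, hj⟩ := exists_le_of_sum_le (s := (univ : Finset (Fin k)))
        ⟨⟨0, hk⟩, mem_univ _⟩ (f := fun j => k * ∑ i, w i j x)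
        (g := fun _ => ∑ l, ∑ i, w i l x) (by simp [← mul_sum])
      exact ⟨j, hj⟩)
    (fun j x hxj => by
      have h0 : ∑ i, w i j x = 0 := sum_eq_zero fun i _ => hfacet i j x hxj
      change k * ∑ i, w i j x ≤ _
      rw [h0, mul_zero]
      exact sum_nonneg fun l _ => sum_nonneg fun i _ => hw i l x)
  -- No column exceeds the average of all columns, so all are equal.
  have heq : ∀ j, k * ∑ i, w i j x = ∑ l, ∑ i, w i l x := fun j =>
    (sum_eq_sum_iff_of_le (s := (univ : Finset (Fin k))) (f := fun j => k * ∑ i, w i j x)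
      (g := fun _ => ∑ l, ∑ i, w i l x) fun j _ => hx j).1
      (by simp [← mul_sum]) j (mem_univ j)
  refine ⟨x, fun J => card_mul_le_of_weights (fun i j => w i j x) (fun i j => hw i j x)
    (fun i => hrow i x) (fun j => (heq j).symm ▸ htot x) J _ fun i hi j hj => ?_⟩
  exact hthick i j x fun hmem => hi (mem_filter.2 ⟨mem_univ _, j, hj, hmem⟩)

open Classical in
theorem Hungry.exists_card_mul_le {p : Fin n → Preference k} (hp : Hungry r p)
    (hk : 0 < k) (hr : 0 < r) (hrn : r ≤ n) :
    ∃ x : CakePartition k, ∀ J : Finset (Fin k), J.card * r ≤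
      k * (univ.filter fun i => ∃ j ∈ J, j ∈ p i x).card := by
  choose u hu using fun N : ℕ => hp.exists_card_mul_le_thickening hk hr hrn
    (Nat.one_div_pos_of_nat (α := ℝ) (n := N))
  obtain ⟨x, φ, hφ, hx⟩ := CompactSpace.tendsto_subseq u
  have hrate : Tendsto (fun m => 1 / ((φ m : ℝ) + 1) + dist (u (φ m)) x) atTop (𝓝 (0 + 0)) :=
    ((tendsto_one_div_add_atTop_nhds_zero_nat (𝕜 := ℝ)).comp hφ.tendsto_atTop).add
      (tendsto_iff_dist_tendsto_zero.1 hx)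
  rw [add_zero] at hrate
  have hev : ∀ i j, ∀ᶠ m in atTop,
      u (φ m) ∈ Metric.thickening (1 / ((φ m : ℝ) + 1)) {y | j ∈ p i y} → j ∈ p i x := by
    intro i j
    by_cases hj : j ∈ p i x
    · exact Eventually.of_forall fun _ _ => hj
    obtain ⟨ε, hε, hball⟩ := Metric.isOpen_iff.1 (hp.closed i j).isOpen_compl x hj
    filter_upwards [hrate.eventually (gt_mem_nhds hε)] with m hm hmem
    obtain ⟨y, hy, hyd⟩ := Metric.mem_thickening_iff.1 hmem
    refine absurd hy (hball ?_)
    rw [Metric.mem_ball]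
    have := dist_triangle y (u (φ m)) x
    rw [dist_comm y (u (φ m))] at this
    linarith
  -- There are finitely many pairs `(i, j)`, so one index `m` serves them all, and hence every `J`.
  obtain ⟨m, hm⟩ := (eventually_all.2 fun i => eventually_all.2 fun j => hev i j).exists
  refine ⟨x, fun J => (hu (φ m) J).trans (Nat.mul_le_mul_left _ (card_le_card fun i hi => ?_))⟩
  obtain ⟨j, hj, hmem⟩ := (mem_filter.1 hi).2
  exact mem_filter.2 ⟨mem_univ _, j, hj, hm i j hmem⟩

end CakeCutting

theorem theorem1p3 (k r n : ℕ) (hk : 0 < k) (hkr : k ≤ r) (hrn : r ≤ n)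
    (p : Fin n → CakeCutting.Preference k) (hp : CakeCutting.Hungry r p) :
    ∃ x : CakeCutting.CakePartition k,
      ∀ S : Finset (Fin n), (S.card : ℤ) = ⌈((r : ℚ) - (k : ℚ)) / (k : ℚ)⌉ →
        ∃ π : Fin k → Fin n, Function.Injective π ∧
          ∀ j : Fin k, π j ∉ S ∧ j ∈ p (π j) x := by
  classical
  obtain ⟨x, hx⟩ := hp.exists_card_mul_le hk (hk.trans_le hkr) hrn
  refine ⟨x, fun S hS => ?_⟩
  -- This is `⌈t⌉ < t + 1` with `t + 1 = r / k`.
  have hSr : S.card * k < r := by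
    have h1 : (S.card : ℚ) < ((r : ℚ) - k) / k + 1 := by
      have := Int.ceil_lt_add_one (((r : ℚ) - k) / k)
      rw [← hS] at this
      exact_mod_cast this
    have hk' : (0 : ℚ) < k := by exact_mod_cast hk
    rw [sub_div, div_self hk'.ne', sub_add_cancel, lt_div_iff₀ hk'] at h1
    exact_mod_cast h1
  refine (Fintype.all_card_le_filter_rel_iff_exists_injective
    fun (j : Fin k) (i : Fin n) => i ∉ S ∧ j ∈ p i x).1 fun J => ?_
  rcases J.eq_empty_or_nonempty with rfl | hJ
  · simp
  have hsub : (Finset.univ.filter fun i => ∃ j ∈ J, j ∈ p i x) ⊆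
      S ∪ Finset.univ.filter fun i => ∃ j ∈ J, i ∉ S ∧ j ∈ p i x := by
    intro i hi
    obtain ⟨j, hj, hji⟩ := (Finset.mem_filter.1 hi).2
    by_cases hiS : i ∈ S
    · exact Finset.mem_union_left _ hiS
    · exact Finset.mem_union_right _ (Finset.mem_filter.2 ⟨Finset.mem_univ _, j, hj, hiS, hji⟩)
  have hcard := (Finset.card_le_card hsub).trans (Finset.card_union_le _ _)
  -- Split `|J| r` as `(|J| - 1) r + r`, then use `k ≤ r` and `hSr`.
  have hlt : k * (J.card - 1 + S.card) <
      k * (Finset.univ.filter fun i => ∃ j ∈ J, j ∈ p i x).card := by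
    refine lt_of_lt_of_le ?_ (hx J)
    obtain ⟨m, hm⟩ := Nat.exists_eq_add_of_lt (Finset.card_pos.2 hJ)
    have hm' : J.card = m + 1 := by omega
    rw [hm', Nat.add_sub_cancel]
    nlinarith [Nat.mul_le_mul_left m hkr]
  have := Nat.lt_of_mul_lt_mul_left hlt
  have hle : J.card ≤ (Finset.univ.filter fun i => ∃ j ∈ J, i ∉ S ∧ j ∈ p i x).card := by omega
  convert hle
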